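/- Equip $\mathbb{C}^2=\mathbb{R}^4$, with coordinates $z_i=x_i+\sqrt{-1}\,y_i$, with the standard symplectic form $\omega=dx_1\wedge dy_1+dx_2\wedge dy_2$. A star-shaped domain is an open subset of $\mathbb{C}^2$ that is star-shaped about one of its points. An embedded Lagrangian torus $L\subset\mathbb{C}^2$ (the image of a smooth embedding of $\mathbb{T}^2$ on which $\omega$ vanishes) has an area class $\Omega\in H^1(L,\mathbb{R})$, $\Omega=[\lambda|_L]$ for any primitive $\lambda$ of $\omega$, for instance $\lambda=-(y_1dx_1+y_2dx_2)$, and a Maslov class $\mu\in H^1(L,\mathbb{Z})$, whose value on the class of a loop $u:S^1\to L$ is the Maslov index of the loop of Lagrangian planes $T_{u(t)}L\subset\mathbb{C}^2$. For a domain $X\subset\mathbb{C}^2$ the reduced shape invariant ${\rm Sh}^+(X)\subset\mathbb{R}^2$ is the set of all pairs $(\Omega(e_1),\Omega(e_2))$, where $L\subset X$ is an embedded Lagrangian torus and $(e_1,e_2)$ is an ordered integral basis of $H_1(L,\mathbb{Z})$ such that $\mu(e_1)=\mu(e_2)=2$, $0<\Omega(e_1)\le\Omega(e_2)$, and moreover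 $2\Omega(e_1)\le\Omega(e_2)$ if $\Omega(e_1)\ne\Omega(e_2)$. Proposition. Let $X,Y$ be star-shaped domains of $\mathbb{C}^2$. If there exists a (smooth) symplectic embedding $\phi:X\to Y$, then ${\rm Sh}^+(X)\subset{\rm Sh}^+(Y)$. In particular, ${\rm Sh}^+$ is a symplectic invariant of star-shaped domains of $\mathbb{C}^2$: if $X$ and $Y$ are symplectomorphic, then ${\rm Sh}^+(X)={\rm Sh}^+(Y)$. -/

import Mathlib

open scoped ContDiff

noncomputable section

namespace ShapeInvariant

/-- The standard symplectic form `dx₁ ∧ dy₁ + dx₂ ∧ dy₂` of `ℂ² = ℝ⁴`, where `zᵢ = xᵢ + i yᵢ`. -/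
def omegaStd (v w : ℂ × ℂ) : ℝ :=
  (v.1.re * w.1.im - v.1.im * w.1.re) + (v.2.re * w.2.im - v.2.im * w.2.re)

/-- The Liouville form `-(y₁ dx₁ + y₂ dx₂)`, a primitive of `omegaStd`, at the point `z`, evaluated
on the tangent vector `v`. -/
def liouville (z v : ℂ × ℂ) : ℝ := -(z.1.im * v.1.re + z.2.im * v.2.re)

/-- A star-shaped domain of `ℂ²`: an open set that is star-shaped about one of its points. -/
def IsStarShapedDomain (X : Set (ℂ × ℂ)) : Prop :=
  IsOpen X ∧ ∃ p ∈ X, StarConvex ℝ p X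

/-- `φ` restricts to a symplectic embedding of the open set `X` into `Y`: it is smooth and injective
on `X`, maps `X` into `Y`, and satisfies `φ^* ω = ω` on `X`. Only the values of `φ` on `X` matter.
(Such a map has invertible differentials, hence is a diffeomorphism onto an open set.) -/
structure IsSymplecticEmbedding (φ : ℂ × ℂ → ℂ × ℂ) (X Y : Set (ℂ × ℂ)) : Prop where
  smooth : ContDiffOn ℝ ∞ φ X
  injOn : Set.InjOn φ X
  mapsTo : Set.MapsTo φ X Y
  symplectic : ∀ z ∈ X, ∀ v w : ℂ × ℂ,
    omegaStd (fderiv ℝ φ z v) (fderiv ℝ φ z w) = omegaStd v w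

/-- The open sets `X` and `Y` are symplectomorphic: there is a diffeomorphism `φ` of `X` onto `Y`,
with smooth inverse `ψ`, such that `φ^* ω = ω`. -/
def Symplectomorphic (X Y : Set (ℂ × ℂ)) : Prop :=
  ∃ φ ψ : ℂ × ℂ → ℂ × ℂ, IsSymplecticEmbedding φ X Y ∧
    ContDiffOn ℝ ∞ ψ Y ∧ Set.MapsTo ψ Y X ∧ Set.InvOn ψ φ X Y

/-- A Lagrangian embedding of the torus `𝕋² = ℝ² / ℤ²` in `ℂ²`, written as a `ℤ²`-periodic map on
`ℝ²`: the induced map on `ℝ² / ℤ²` is well defined, injective, smooth and an immersion (hence an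
embedding, the torus being compact), and it pulls `ω` back to zero. -/
structure IsLagrangianTorusEmbedding (f : ℝ × ℝ → ℂ × ℂ) : Prop where
  smooth : ContDiff ℝ ∞ f
  eq_iff : ∀ p q : ℝ × ℝ, f p = f q ↔ ∃ m n : ℤ, q = p + ((m : ℝ), (n : ℝ))
  immersion : ∀ p : ℝ × ℝ, Function.Injective (fderiv ℝ f p)
  lagrangian : ∀ p v w : ℝ × ℝ, omegaStd (fderiv ℝ f p v) (fderiv ℝ f p w) = 0

/-- An embedded Lagrangian torus in `ℂ²`, as a subset. -/
def IsLagrangianTorus (L : Set (ℂ × ℂ)) : Prop :=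
  ∃ f : ℝ × ℝ → ℂ × ℂ, IsLagrangianTorusEmbedding f ∧ Set.range f = L

/-- The tangent space `T_p L` of a submanifold `L` of `ℂ²` at `p`, spanned by the velocities at `p`
of the smooth curves in `L`. -/
def tangentSpaceAt (L : Set (ℂ × ℂ)) (p : ℂ × ℂ) : Submodule ℝ (ℂ × ℂ) :=
  Submodule.span ℝ {v | ∃ γ : ℝ → ℂ × ℂ, ContDiff ℝ ∞ γ ∧ (∀ t, γ t ∈ L) ∧ γ 0 = p ∧ deriv γ 0 = v}

/-- The complex determinant of the matrix with columns `v` and `w`. -/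
def detC (v w : ℂ × ℂ) : ℂ := v.1 * w.2 - v.2 * w.1

/-- The loop `Λ(t)`, `0 ≤ t ≤ 1`, of Lagrangian planes in `ℂ²` has Maslov index `k`.
If `(v(t), w(t))` is a continuous real frame of `Λ(t)`, then `det² / |det|²` for
`det = det_ℂ (v(t), w(t))` depends only on `Λ(t)`, because a change of the real frame multiplies
`det` by a real number. (For an orthonormal frame it is the usual `det² U(t)`, where
`Λ(t) = U(t) ℝ²` with `U(t)` unitary.) The Maslov index is the degree of this loop in the circle,
computed by means of a continuous lift `2 π α(t)` of its argument. -/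
def HasMaslovIndex (Λ : ℝ → Submodule ℝ (ℂ × ℂ)) (k : ℤ) : Prop :=
  ∃ (v w : ℝ → ℂ × ℂ) (α : ℝ → ℝ),
    ContinuousOn v (Set.Icc 0 1) ∧ ContinuousOn w (Set.Icc 0 1) ∧ ContinuousOn α (Set.Icc 0 1) ∧
    (∀ t ∈ Set.Icc (0 : ℝ) 1,
      Λ t = Submodule.span ℝ {v t, w t} ∧ detC (v t) (w t) ≠ 0 ∧
      detC (v t) (w t) ^ 2 =
        ((‖detC (v t) (w t)‖ ^ 2 : ℝ) : ℂ) * Complex.exp (2 * Real.pi * α t * Complex.I)) ∧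
    α 1 - α 0 = k

/-- Smooth loops `u : S¹ = ℝ / ℤ → L` based at `x`, as maps to `ℂ²` with values in `L`. -/
structure SmoothLoop (L : Set (ℂ × ℂ)) (x : L) where
  toFun : ℝ → ℂ × ℂ
  smooth : ContDiff ℝ ∞ toFun
  periodic : Function.Periodic toFun 1
  mem : ∀ t, toFun t ∈ L
  base : toFun 0 = x

/-- `H₁(L, ℤ)` for a path-connected space `L` (such as a torus), as the abelianized fundamental
group at a base point `x`, written additively. -/
abbrev H1 (L : Set (ℂ × ℂ)) (x : L) : Type := Additive (Abelianization (FundamentalGroup L x))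

namespace SmoothLoop

variable {L : Set (ℂ × ℂ)} {x : L}

/-- The underlying continuous loop in `L`. -/
def path (u : SmoothLoop L x) : Path x x where
  toFun t := ⟨u.toFun t, u.mem t⟩
  continuous_toFun :=
    Continuous.subtype_mk (u.smooth.continuous.comp continuous_subtype_val) _
  source' := Subtype.ext (by simpa using u.base)
  target' := Subtype.ext (by
    have h := u.periodic 0
    rw [zero_add] at h
    simpa [h] using u.base)

/-- The homology class `u_*[S¹]`. -/
def homologyClass (u : SmoothLoop L x) : H1 L x :=
  Additive.ofMul (Abelianization.of (FundamentalGroup.fromPath (Path.Homotopic.Quotient.mk u.path)))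

/-- The integral of the Liouville form along `u`. -/
def area (u : SmoothLoop L x) : ℝ :=
  ∫ t in (0 : ℝ)..1, liouville (u.toFun t) (deriv u.toFun t)

end SmoothLoop

/-- The area class `Ω` of `L` takes the value `a` on `e ∈ H₁(L, ℤ)`: some smooth loop in `L` that
represents `e` has area `a`. (If `L` is Lagrangian, all such loops have the same area.) -/
def HasAreaOn {L : Set (ℂ × ℂ)} {x : L} (e : H1 L x) (a : ℝ) : Prop :=
  ∃ u : SmoothLoop L x, u.homologyClass = e ∧ u.area = a

/-- The Maslov class `μ` of `L` takes the value `k` on `e ∈ H₁(L, ℤ)`: for some smooth loop `u` in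
`L` that represents `e`, the loop `t ↦ T_{u(t)} L` of Lagrangian planes has Maslov index `k`.
(If `L` is Lagrangian, all such loops give the same index.) -/
def HasMaslovOn {L : Set (ℂ × ℂ)} {x : L} (e : H1 L x) (k : ℤ) : Prop :=
  ∃ u : SmoothLoop L x, u.homologyClass = e ∧
    HasMaslovIndex (fun t => tangentSpaceAt L (u.toFun t)) k

/-- The reduced shape invariant `Sh⁺(X)`: the pairs `(Ω(e₁), Ω(e₂))` for the Lagrangian tori `L` in
`X` and the ordered integral bases `(e₁, e₂)` of `H₁(L, ℤ)` with `μ(e₁) = μ(e₂) = 2` and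
`0 < Ω(e₁) ≤ Ω(e₂)` and, if `Ω(e₁) ≠ Ω(e₂)` (the non-monotone case), `2 Ω(e₁) ≤ Ω(e₂)`. -/
def reducedShape (X : Set (ℂ × ℂ)) : Set (ℝ × ℝ) :=
  {s | ∃ L : Set (ℂ × ℂ), IsLagrangianTorus L ∧ L ⊆ X ∧
    ∃ (x : L) (e : Module.Basis (Fin 2) ℤ (H1 L x)),
      HasMaslovOn (e 0) 2 ∧ HasMaslovOn (e 1) 2 ∧
      HasAreaOn (e 0) s.1 ∧ HasAreaOn (e 1) s.2 ∧
      0 < s.1 ∧ s.1 ≤ s.2 ∧ (s.1 ≠ s.2 → 2 * s.1 ≤ s.2)}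

end ShapeInvariant

end

namespace ShapeInvariant

/-! If `L ⊆ X` is a Lagrangian torus, so is `φ '' L ⊆ Y`, and the homeomorphism `L ≃ₜ φ '' L`
carries integral bases of `H₁` to integral bases. It remains to see that areas and Maslov indices of
loops are unchanged; both follow by contracting `X` to its center `p`.

Area (`area_mapLoop`): since `φ^*ω = ω`, the form `φ^*λ - λ` is closed on `X`, so its integral over
every loop in the star-shaped set `X` vanishes.

Maslov index (`hasMaslovIndex_image`): tangent planes of `φ '' L` are the images of those of `L`
under `dφ`, so the plane loop along `u` is moved by the loop `dφ_{u(t)}` of symplectic maps.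
Contracting `u` to `p` deforms this loop to the constant `A₀ = dφ_p`. The effect of `A₀` is handled
without using connectedness of the symplectic group: the maps `A₀ - r i A₀ i`, `0 ≤ r ≤ 1`, need not
be symplectic, but they send Lagrangian planes to totally real ones (`complexify_totallyReal`), so
the complex determinant of a frame never vanishes. At `r = 1` the map is complex linear and only
multiplies that determinant by a constant. Homotopy invariance of the winding
(`HasSquareWinding.of_homotopy`) concludes. -/

/-! ### Symplectic linear algebra and totally real planes. -/

/-- A real-linear endomorphism of `ℂ²` that preserves `omegaStd`. -/
def IsSymplecticMap (A : ℂ × ℂ →L[ℝ] ℂ × ℂ) : Prop :=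
  ∀ v w, omegaStd (A v) (A w) = omegaStd v w

/-- The family `A - r i A i`, from `A` at `r = 0` to twice the complex-linear part of `A` at
`r = 1`. -/
noncomputable def complexify (A : ℂ × ℂ →L[ℝ] ℂ × ℂ) (r : ℝ) (v : ℂ × ℂ) : ℂ × ℂ :=
  A v - r • Complex.I • A (Complex.I • v)

/-- Multiplication by `i` is compatible with `ω`: the value is the squared Euclidean norm of `v`. -/
theorem omegaStd_I_smul_nonneg (v : ℂ × ℂ) : 0 ≤ omegaStd v (Complex.I • v) := by
  simp [omegaStd]; nlinarith [sq_nonneg v.1.re, sq_nonneg v.1.im, sq_nonneg v.2.re,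
    sq_nonneg v.2.im]

theorem eq_zero_of_omegaStd_I_smul {v : ℂ × ℂ} (h : omegaStd v (Complex.I • v) ≤ 0) : v = 0 := by
  simp only [omegaStd, Prod.smul_fst, Prod.smul_snd, smul_eq_mul, Complex.mul_im, Complex.I_re,
    Complex.I_im, Complex.mul_re, zero_mul, one_mul, zero_add, zero_sub, mul_neg] at h
  refine Prod.ext (Complex.ext ?_ ?_) (Complex.ext ?_ ?_) <;> simp only [Prod.fst_zero,
    Prod.snd_zero, Complex.zero_re, Complex.zero_im] <;>
  nlinarith [sq_nonneg v.1.re, sq_nonneg v.1.im, sq_nonneg v.2.re, sq_nonneg v.2.im]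

theorem IsSymplecticMap.eq_zero {A : ℂ × ℂ →L[ℝ] ℂ × ℂ} (hA : IsSymplecticMap A) {v : ℂ × ℂ}
    (h : A v = 0) : v = 0 := by
  apply eq_zero_of_omegaStd_I_smul
  rw [← hA, h]
  simp [omegaStd]

/-- The maps `complexify A r` send Lagrangian planes to totally real planes. -/
theorem IsSymplecticMap.complexify_totallyReal {A : ℂ × ℂ →L[ℝ] ℂ × ℂ} (hA : IsSymplecticMap A)
    {r : ℝ} (hr : 0 ≤ r) {h k : ℂ × ℂ} (hk : omegaStd h k = 0)
    (e : complexify A r h = Complex.I • complexify A r k) : h = 0 ∧ k = 0 := by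
  -- Collecting the terms of `e` inside `A` gives `A x = i A w`. Then `|A x|² = ω(A x, i A x) =
  -- -ω(x, w) = -r (|h|² + |k|²) ≤ 0`, which forces `A x = 0`.
  set x := h - r • Complex.I • k with hx
  set w := k + r • Complex.I • h with hw
  have e1 : A x = Complex.I • A w := by
    have hI : ∀ y : ℂ × ℂ, Complex.I • Complex.I • y = -y := fun y => by
      rw [smul_smul, Complex.I_mul_I, neg_one_smul]
    simp only [complexify, smul_sub, smul_comm Complex.I r, hI] at e
    simp only [hx, hw, map_sub, map_add, map_smul, smul_add, smul_comm Complex.I r]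
    rw [sub_eq_iff_eq_add] at e ⊢
    rw [e]; module
  have e2 : omegaStd (A x) (Complex.I • A x) = -omegaStd x w := by
    rw [← hA x w, e1]
    generalize A w = y
    simp [omegaStd]; ring
  have e3 : omegaStd x w
      = r * (omegaStd h (Complex.I • h) + omegaStd k (Complex.I • k)) := by
    have : omegaStd x w = (1 - r ^ 2) * omegaStd h k + r * (omegaStd h (Complex.I • h)
        + omegaStd k (Complex.I • k)) + 2 * r ^ 2 * omegaStd h k := by
      simp [hx, hw, omegaStd]; ring
    rw [this, hk]; ring
  have hh := omegaStd_I_smul_nonneg h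
  have hkk := omegaStd_I_smul_nonneg k
  have hAx : A x = 0 := eq_zero_of_omegaStd_I_smul (by
    rw [e2, e3]; linarith [mul_nonneg hr (add_nonneg hh hkk)])
  have hAw : A w = 0 := by
    rw [e1] at hAx
    exact (smul_eq_zero.mp hAx).resolve_left Complex.I_ne_zero
  have hx0 := hA.eq_zero hAx
  have hw0 := hA.eq_zero hAw
  rcases hr.eq_or_lt with rfl | hr
  · simp only [hx, hw, zero_smul, sub_zero, add_zero] at hx0 hw0
    exact ⟨hx0, hw0⟩
  · have h0 : omegaStd h (Complex.I • h) + omegaStd k (Complex.I • k) = 0 := by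
      have : r * (omegaStd h (Complex.I • h) + omegaStd k (Complex.I • k)) = 0 := by
        rw [← e3, hx0]; simp [omegaStd]
      exact (mul_eq_zero.mp this).resolve_left hr.ne'
    exact ⟨eq_zero_of_omegaStd_I_smul (by linarith), eq_zero_of_omegaStd_I_smul (by linarith)⟩

theorem complexify_add (A : ℂ × ℂ →L[ℝ] ℂ × ℂ) (r : ℝ) (v w : ℂ × ℂ) :
    complexify A r (v + w) = complexify A r v + complexify A r w := by
  simp only [complexify, smul_add, map_add]; abel

theorem complexify_smul (A : ℂ × ℂ →L[ℝ] ℂ × ℂ) (r c : ℝ) (v : ℂ × ℂ) :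
    complexify A r (c • v) = c • complexify A r v := by
  simp only [complexify, smul_comm Complex.I c, map_smul, smul_sub, smul_comm r c]

theorem complexify_zero (A : ℂ × ℂ →L[ℝ] ℂ × ℂ) (v : ℂ × ℂ) : complexify A 0 v = A v := by
  simp [complexify]

theorem exists_smul_add_smul_eq_zero {a b : ℂ × ℂ} (h : detC a b = 0) :
    ∃ c d : ℂ, (c ≠ 0 ∨ d ≠ 0) ∧ c • a + d • b = 0 := by
  have h' : a.1 * b.2 - a.2 * b.1 = 0 := h
  by_cases h1 : b.1 ≠ 0 ∨ a.1 ≠ 0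
  · refine ⟨b.1, -a.1, by simpa using h1, Prod.ext ?_ ?_⟩ <;> simp
    · ring
    · linear_combination -h'
  · by_cases h2 : b.2 ≠ 0 ∨ a.2 ≠ 0
    · refine ⟨b.2, -a.2, by simpa using h2, Prod.ext ?_ ?_⟩ <;> simp
      · linear_combination h'
      · ring
    · push Not at h1 h2
      exact ⟨1, 0, by simp, Prod.ext (by simp [h1]) (by simp [h2])⟩

theorem eq_zero_of_smul_add_smul_eq_zero {v w : ℂ × ℂ} (h : detC v w ≠ 0) {a b : ℝ}
    (e : a • v + b • w = 0) : a = 0 ∧ b = 0 := by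
  have e1 := congrArg Prod.fst e
  have e2 := congrArg Prod.snd e
  simp at e1 e2
  have ha : (a : ℂ) * detC v w = 0 := by
    rw [detC]; linear_combination w.2 * e1 - w.1 * e2
  have hb : (b : ℂ) * detC v w = 0 := by
    rw [detC]; linear_combination v.1 * e2 - v.2 * e1
  exact ⟨by simpa [h] using ha, by simpa [h] using hb⟩

theorem IsSymplecticMap.detC_complexify_ne_zero {A : ℂ × ℂ →L[ℝ] ℂ × ℂ} (hA : IsSymplecticMap A)
    {r : ℝ} (hr : 0 ≤ r) {v w : ℂ × ℂ} (h0 : omegaStd v w = 0) (h : detC v w ≠ 0) :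
    detC (complexify A r v) (complexify A r w) ≠ 0 := by
  intro hd
  obtain ⟨c, d, hcd, e⟩ := exists_smul_add_smul_eq_zero hd
  -- Splitting `c` and `d` into real and imaginary parts turns the complex relation into `B h = i B
  -- k` for the real-linear map `B = complexify A r`, with `h` and `k` in the Lagrangian plane of
  -- `v, w`.
  have key := hA.complexify_totallyReal hr (h := c.re • v + d.re • w)
    (k := -(c.im • v + d.im • w)) (by
      have : omegaStd (c.re • v + d.re • w) (-(c.im • v + d.im • w))
          = (d.re * c.im - c.re * d.im) * omegaStd v w := by
        simp [omegaStd]; ring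
      rw [this, h0, mul_zero]) (by
      rw [← neg_one_smul ℝ (c.im • v + d.im • w)]
      simp only [complexify_add, complexify_smul]
      generalize complexify A r v = a at *
      generalize complexify A r w = b at *
      have hc : ∀ (z : ℂ) (y : ℂ × ℂ), z • y = z.re • y + Complex.I • z.im • y := fun z y => by
        refine Prod.ext ?_ ?_ <;> simp
        · linear_combination -y.1 * Complex.re_add_im z
        · linear_combination -y.2 * Complex.re_add_im z
      rw [hc c, hc d] at e
      rw [← sub_eq_zero, ← e]
      simp only [smul_add, neg_smul, one_smul, smul_neg]
      abel)
  obtain ⟨h1, h2⟩ := eq_zero_of_smul_add_smul_eq_zero h key.1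
  obtain ⟨h3, h4⟩ := eq_zero_of_smul_add_smul_eq_zero h (neg_eq_zero.mp key.2)
  rcases hcd with hc | hd
  · exact hc (Complex.ext h1 h3)
  · exact hd (Complex.ext h2 h4)

theorem IsSymplecticMap.detC_ne_zero {A : ℂ × ℂ →L[ℝ] ℂ × ℂ} (hA : IsSymplecticMap A)
    {v w : ℂ × ℂ} (h0 : omegaStd v w = 0) (h : detC v w ≠ 0) : detC (A v) (A w) ≠ 0 := by
  simpa only [complexify_zero] using hA.detC_complexify_ne_zero le_rfl h0 h

/-- At `r = 1` the map commutes with `i`, and `c` is its complex determinant. -/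
theorem exists_detC_complexify_one (A : ℂ × ℂ →L[ℝ] ℂ × ℂ) :
    ∃ c : ℂ, ∀ v w, detC (complexify A 1 v) (complexify A 1 w) = c * detC v w := by
  have hI : ∀ v, complexify A 1 (Complex.I • v) = Complex.I • complexify A 1 v := fun v => by
    have h1 : Complex.I • Complex.I • v = -v := by
      rw [smul_smul, Complex.I_mul_I, neg_one_smul]
    simp only [complexify, h1, map_neg, smul_sub, one_smul, smul_neg, smul_smul Complex.I,
      Complex.I_mul_I, neg_one_smul]
    abel
  have hlin : ∀ v : ℂ × ℂ, complexify A 1 v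
      = v.1 • complexify A 1 (1, 0) + v.2 • complexify A 1 (0, 1) := fun v => by
    have hv : v = v.1.re • ((1, 0) : ℂ × ℂ) + v.1.im • Complex.I • ((1, 0) : ℂ × ℂ)
        + (v.2.re • ((0, 1) : ℂ × ℂ) + v.2.im • Complex.I • ((0, 1) : ℂ × ℂ)) := by
      refine Prod.ext ?_ ?_ <;> simp
    conv_lhs => rw [hv]
    simp only [complexify_add, complexify_smul, hI]
    generalize complexify A 1 (1, 0) = a, complexify A 1 (0, 1) = b
    refine Prod.ext ?_ ?_ <;> simp
    · linear_combination a.1 * Complex.re_add_im v.1 + b.1 * Complex.re_add_im v.2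
    · linear_combination a.2 * Complex.re_add_im v.1 + b.2 * Complex.re_add_im v.2
  refine ⟨detC (complexify A 1 (1, 0)) (complexify A 1 (0, 1)), fun v w => ?_⟩
  rw [hlin v, hlin w]
  simp [detC]; ring

/-- A real change of frame multiplies `detC` by a real number. -/
theorem detC_eq_mul_of_mem_span {v w v' w' : ℂ × ℂ} (hv : v' ∈ Submodule.span ℝ {v, w})
    (hw : w' ∈ Submodule.span ℝ {v, w}) :
    ∃ c : ℝ, ∀ B : ℂ × ℂ → ℂ × ℂ, (∀ x y, B (x + y) = B x + B y) →
      (∀ (a : ℝ) x, B (a • x) = a • B x) → detC (B v') (B w') = c * detC (B v) (B w) := by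
  obtain ⟨a, b, rfl⟩ := Submodule.mem_span_pair.mp hv
  obtain ⟨a', b', rfl⟩ := Submodule.mem_span_pair.mp hw
  refine ⟨a * b' - b * a', fun B hadd hsmul => ?_⟩
  simp [hadd, hsmul, detC]; ring

/-! ### Winding numbers of squared determinants. -/

/-- The winding of `g ^ 2 / ‖g‖ ^ 2` along `[0, 1]`, computed by means of a continuous lift `2 π α`
of its argument, is `k`. -/
def HasSquareWinding (g : ℝ → ℂ) (k : ℝ) : Prop :=
  ∃ α : ℝ → ℝ, ContinuousOn α (Set.Icc 0 1) ∧
    (∀ t ∈ Set.Icc (0 : ℝ) 1,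
      g t ^ 2 = ((‖g t‖ ^ 2 : ℝ) : ℂ) * Complex.exp (2 * Real.pi * α t * Complex.I)) ∧
    α 1 - α 0 = k

theorem HasSquareWinding.congr {g h : ℝ → ℂ} {k : ℝ} (hg : HasSquareWinding g k)
    (e : ∀ t ∈ Set.Icc (0 : ℝ) 1, h t = g t) : HasSquareWinding h k := by
  obtain ⟨α, hα, hα', hk⟩ := hg
  exact ⟨α, hα, fun t ht => by rw [e t ht, hα' t ht], hk⟩

theorem sq_eq_norm_sq_mul_exp (q : ℂ) :
    q ^ 2 = ((‖q‖ ^ 2 : ℝ) : ℂ) * Complex.exp (2 * Real.pi * (q.arg / Real.pi : ℝ) * Complex.I) := by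
  have h : (2 * Real.pi * (q.arg / Real.pi : ℝ) * Complex.I : ℂ)
      = ((2 : ℕ) : ℂ) * (q.arg * Complex.I) := by
    have : (Real.pi : ℂ) ≠ 0 := by exact_mod_cast Real.pi_ne_zero
    push_cast; field_simp
  rw [h, Complex.exp_nat_mul]
  push_cast
  rw [← mul_pow, Complex.norm_mul_exp_arg_mul_I]

/-- The principal argument is continuous on the slit plane, so `arg q / π` lifts the factor `q ^ 2`;
equal end arguments make its contribution cancel. -/
theorem HasSquareWinding.mul {g q : ℝ → ℂ} {k : ℝ} (hg : HasSquareWinding g k)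
    (hq : ContinuousOn q (Set.Icc 0 1)) (hre : ∀ t ∈ Set.Icc (0 : ℝ) 1, q t ∈ Complex.slitPlane)
    (harg : (q 1).arg = (q 0).arg) : HasSquareWinding (fun t => g t * q t) k := by
  obtain ⟨α, hα, hα', hk⟩ := hg
  refine ⟨fun t => α t + (q t).arg / Real.pi, hα.add (ContinuousOn.div_const (fun t ht =>
    (Complex.continuousAt_arg (hre t ht)).comp_continuousWithinAt (hq t ht)) _),
    fun t ht => ?_, by simp only [harg]; rw [← hk]; ring⟩
  have e : (2 * Real.pi * ((α t + (q t).arg / Real.pi : ℝ) : ℂ) * Complex.I : ℂ)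
      = 2 * Real.pi * α t * Complex.I + 2 * Real.pi * ((q t).arg / Real.pi : ℝ) * Complex.I := by
    push_cast; ring
  simp only [mul_pow, norm_mul]
  rw [e, Complex.exp_add, hα' t ht, sq_eq_norm_sq_mul_exp (q t)]
  push_cast
  ring

theorem HasSquareWinding.const_mul {g : ℝ → ℂ} {k : ℝ} {c : ℂ}
    (hg : HasSquareWinding (fun t => c * g t) k) (hc : c ≠ 0) : HasSquareWinding g k := by
  obtain ⟨α, hα, hα', hk⟩ := hg
  refine ⟨fun t => α t - c.arg / Real.pi, hα.sub continuousOn_const, fun t ht => ?_,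
    by rw [← hk]; ring⟩
  have e : (2 * Real.pi * ((α t - c.arg / Real.pi : ℝ) : ℂ) * Complex.I : ℂ)
      = 2 * Real.pi * α t * Complex.I - 2 * Real.pi * (c.arg / Real.pi : ℝ) * Complex.I := by
    push_cast; ring
  have h := hα' t ht
  simp only [mul_pow, norm_mul] at h
  rw [sq_eq_norm_sq_mul_exp c] at h
  have hc' : ((‖c‖ ^ 2 : ℝ) : ℂ) ≠ 0 := by
    exact_mod_cast pow_ne_zero 2 (norm_ne_zero_iff.mpr hc)
  rw [e, Complex.exp_sub, mul_div_assoc', eq_div_iff (Complex.exp_ne_zero _)]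
  apply mul_left_cancel₀ hc'
  push_cast at h ⊢
  linear_combination h

/-- Nearby loops with proportional end values (over the reals) have the same winding. -/
theorem HasSquareWinding.of_norm_sub_lt {g h : ℝ → ℂ} {k : ℝ} (hw : HasSquareWinding g k)
    (hg : ContinuousOn g (Set.Icc 0 1)) (hh : ContinuousOn h (Set.Icc 0 1))
    (hlt : ∀ t ∈ Set.Icc (0 : ℝ) 1, ‖h t - g t‖ < ‖g t‖)
    {a b : ℝ} (ha : g 1 = a * g 0) (hb : h 1 = b * h 0) : HasSquareWinding h k := by
  have hg0 : ∀ t ∈ Set.Icc (0 : ℝ) 1, g t ≠ 0 := fun t ht h0 => by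
    have := hlt t ht
    rw [h0, norm_zero] at this
    exact absurd this (norm_nonneg _).not_gt
  have hre : ∀ t ∈ Set.Icc (0 : ℝ) 1, 0 < (h t / g t).re := fun t ht => by
    have h1 : ‖h t / g t - 1‖ < 1 := by
      rw [div_sub_one (hg0 t ht), norm_div, div_lt_one (norm_pos_iff.mpr (hg0 t ht))]
      exact hlt t ht
    have h2 := (abs_le.mp ((Complex.abs_re_le_norm _).trans h1.le)).1
    have h3 := (abs_lt.mp ((Complex.abs_re_le_norm _).trans_lt h1)).1
    simp at h3
    linarith
  have h0 : (0 : ℝ) ∈ Set.Icc (0 : ℝ) 1 := by simp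
  have h1 : (1 : ℝ) ∈ Set.Icc (0 : ℝ) 1 := by simp
  refine (hw.mul (q := fun t => h t / g t) (hh.div hg hg0) (fun t ht => Or.inl (hre t ht)) ?_).congr
    fun t ht => (mul_div_cancel₀ _ (hg0 t ht)).symm
  -- The end quotients differ by the real factor `b / a`. It is positive because both quotients have
  -- positive real part, so their arguments agree.
  have hq : h 1 / g 1 = ((b / a : ℝ) : ℂ) * (h 0 / g 0) := by
    rw [ha, hb]; push_cast; rw [mul_div_mul_comm]
  have hpos : 0 < b / a := by
    have e := hre 1 h1
    rw [hq, Complex.re_ofReal_mul] at e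
    exact pos_of_mul_pos_left e (hre 0 h0).le
  simp only [hq]
  exact Complex.arg_real_mul _ hpos

/-- Homotopy invariance of the winding, for loops of nonzero complex numbers up to real factors. -/
theorem HasSquareWinding.of_homotopy {H : ℝ × ℝ → ℂ}
    (hH : ContinuousOn H (Set.Icc 0 1 ×ˢ Set.Icc 0 1))
    (h0 : ∀ x ∈ Set.Icc (0 : ℝ) 1 ×ˢ Set.Icc (0 : ℝ) 1, H x ≠ 0)
    (hend : ∀ s ∈ Set.Icc (0 : ℝ) 1, ∃ a : ℝ, H (s, 1) = a * H (s, 0)) {k : ℝ}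
    (hk : HasSquareWinding (fun t => H (0, t)) k) : HasSquareWinding (fun t => H (1, t)) k := by
  have hc : IsCompact (Set.Icc (0 : ℝ) 1 ×ˢ Set.Icc (0 : ℝ) 1) := isCompact_Icc.prod isCompact_Icc
  -- With the minimum of `‖H‖` as tolerance in uniform continuity, slices at distance `1 / (N + 1)`
  -- satisfy the hypothesis of `of_norm_sub_lt`.
  obtain ⟨x₀, hx₀, hmin⟩ := hc.exists_isMinOn ⟨(0, 0), by simp⟩ hH.norm
  have hm : 0 < ‖H x₀‖ := norm_pos_iff.mpr (h0 x₀ hx₀)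
  obtain ⟨δ, hδ, hunif⟩ := Metric.uniformContinuousOn_iff.mp
    (hc.uniformContinuousOn_of_continuous hH) _ hm
  obtain ⟨N, hN⟩ := exists_nat_one_div_lt hδ
  have hN0 : (0 : ℝ) < N + 1 := by positivity
  have hslice : ∀ s ∈ Set.Icc (0 : ℝ) 1, ContinuousOn (fun t => H (s, t)) (Set.Icc 0 1) :=
    fun s hs => hH.comp (by fun_prop) fun t ht => ⟨hs, ht⟩
  have hmem : ∀ j : ℕ, j ≤ N + 1 → (j / (N + 1) : ℝ) ∈ Set.Icc (0 : ℝ) 1 := fun j hj =>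
    ⟨by positivity, (div_le_one hN0).mpr (by exact_mod_cast hj)⟩
  have hind : ∀ j : ℕ, j ≤ N + 1 → HasSquareWinding (fun t => H (j / (N + 1), t)) k := by
    intro j
    induction j with
    | zero => intro _; simpa using hk
    | succ j ih =>
      intro hj
      have hs := hmem j (by omega)
      have hs' := hmem (j + 1) hj
      obtain ⟨a, ha⟩ := hend _ hs
      obtain ⟨b, hb⟩ := hend _ hs'
      refine (ih (by omega)).of_norm_sub_lt (hslice _ hs) (hslice _ hs') (fun t ht => ?_) ha hb
      rw [← dist_eq_norm]
      refine (hunif _ ⟨hs', ht⟩ _ ⟨hs, ht⟩ ?_).trans_le (hmin ⟨hs, ht⟩)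
      rw [Prod.dist_eq, dist_self, max_eq_left dist_nonneg, Real.dist_eq, ← sub_div]
      push_cast
      rw [add_sub_cancel_left, abs_of_pos (by positivity)]
      exact hN
  have := hind (N + 1) le_rfl
  push_cast at this
  simpa [div_self hN0.ne'] using this

theorem continuousOn_detC {α : Type*} [TopologicalSpace α] {s : Set α} {v w : α → ℂ × ℂ}
    (hv : ContinuousOn v s) (hw : ContinuousOn w s) : ContinuousOn (fun t => detC (v t) (w t)) s :=
  (hv.fst.mul hw.snd).sub (hv.snd.mul hw.fst)

/-- The Maslov index of a loop of Lagrangian planes does not change under a loop of linear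
symplectic maps that is homotopic to a constant loop. -/
theorem HasSquareWinding.of_symplectic_homotopy {A : ℝ × ℝ → ℂ × ℂ →L[ℝ] ℂ × ℂ}
    (hA : ContinuousOn A (Set.Icc 0 1 ×ˢ Set.Icc 0 1))
    (hsymp : ∀ x ∈ Set.Icc (0 : ℝ) 1 ×ˢ Set.Icc (0 : ℝ) 1, IsSymplecticMap (A x))
    (hend : ∀ s ∈ Set.Icc (0 : ℝ) 1, A (s, 1) = A (s, 0)) {A₀ : ℂ × ℂ →L[ℝ] ℂ × ℂ}
    (hconst : ∀ t ∈ Set.Icc (0 : ℝ) 1, A (0, t) = A₀) {v w : ℝ → ℂ × ℂ}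
    (hv : ContinuousOn v (Set.Icc 0 1)) (hw : ContinuousOn w (Set.Icc 0 1))
    (hdet : ∀ t ∈ Set.Icc (0 : ℝ) 1, detC (v t) (w t) ≠ 0)
    (hlag : ∀ t ∈ Set.Icc (0 : ℝ) 1, omegaStd (v t) (w t) = 0)
    (hv1 : v 1 ∈ Submodule.span ℝ {v 0, w 0}) (hw1 : w 1 ∈ Submodule.span ℝ {v 0, w 0}) {k : ℝ}
    (hk : HasSquareWinding (fun t => detC (v t) (w t)) k) :
    HasSquareWinding (fun t => detC (A (1, t) (v t)) (A (1, t) (w t))) k := by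
  have hI0 : (0 : ℝ) ∈ Set.Icc (0 : ℝ) 1 := by simp
  have hA₀ : IsSymplecticMap A₀ := hconst 0 hI0 ▸ hsymp (0, 0) ⟨hI0, hI0⟩
  obtain ⟨ρ, hρ⟩ := detC_eq_mul_of_mem_span hv1 hw1
  have hv' : ContinuousOn (fun x : ℝ × ℝ => v x.2) (Set.Icc 0 1 ×ˢ Set.Icc 0 1) :=
    hv.comp continuousOn_snd fun x hx => hx.2
  have hw' : ContinuousOn (fun x : ℝ × ℝ => w x.2) (Set.Icc 0 1 ×ˢ Set.Icc 0 1) :=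
    hw.comp continuousOn_snd fun x hx => hx.2
  have hcx : ∀ {y : ℝ → ℂ × ℂ}, ContinuousOn (fun x : ℝ × ℝ => y x.2)
      (Set.Icc 0 1 ×ˢ Set.Icc 0 1) → ContinuousOn
      (fun x : ℝ × ℝ => complexify A₀ (1 - x.1) (y x.2)) (Set.Icc 0 1 ×ˢ Set.Icc 0 1) :=
    fun {y} hy => by
      unfold complexify
      have h1 : ContinuousOn (fun x : ℝ × ℝ => A₀ (y x.2)) (Set.Icc 0 1 ×ˢ Set.Icc 0 1) :=
        A₀.continuous.comp_continuousOn hy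
      have h2 : ContinuousOn (fun x : ℝ × ℝ => A₀ (Complex.I • y x.2))
          (Set.Icc 0 1 ×ˢ Set.Icc 0 1) :=
        A₀.continuous.comp_continuousOn (hy.const_smul Complex.I)
      have h3 : ContinuousOn (fun x : ℝ × ℝ => 1 - x.1) (Set.Icc 0 1 ×ˢ Set.Icc 0 1) := by fun_prop
      exact h1.sub (h3.smul (h2.const_smul Complex.I))
  obtain ⟨c, hc⟩ := exists_detC_complexify_one A₀
  have hc0 : c ≠ 0 := fun h0 => by
    have := hA₀.detC_complexify_ne_zero zero_le_one (hlag 0 hI0) (hdet 0 hI0)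
    rw [hc, h0, zero_mul] at this
    exact this rfl
  -- Start at the complex-linear end, where the determinant is just rescaled by `c`. The parameter
  -- `1 - s` then leads back to `A₀`, and the given homotopy leads from `A₀` to the loop `A (1, t)`.
  have step0 : HasSquareWinding (fun t => c * detC (v t) (w t)) k :=
    HasSquareWinding.const_mul (c := c⁻¹)
      (hk.congr fun t _ => inv_mul_cancel_left₀ hc0 _) (inv_ne_zero hc0)
  have step1 : HasSquareWinding (fun t => detC (A₀ (v t)) (A₀ (w t))) k := by
    refine (HasSquareWinding.of_homotopy (H := fun x =>
      detC (complexify A₀ (1 - x.1) (v x.2)) (complexify A₀ (1 - x.1) (w x.2)))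
      (continuousOn_detC (hcx hv') (hcx hw')) (fun x hx => ?_) (fun s _ => ?_)
      (step0.congr fun t _ => ?_)).congr fun t _ => ?_
    · exact hA₀.detC_complexify_ne_zero (sub_nonneg.mpr hx.1.2) (hlag _ hx.2) (hdet _ hx.2)
    -- The frame-change factor `ρ` depends only on the two end frames, so it serves every
    -- real-linear map along the homotopy.
    · exact ⟨ρ, hρ _ (complexify_add _ _) fun a y => complexify_smul _ _ a y⟩
    · simp only [sub_zero, hc]
    · simp only [sub_self, complexify_zero]
  refine HasSquareWinding.of_homotopy (H := fun x => detC (A x (v x.2)) (A x (w x.2)))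
      (continuousOn_detC (hA.clm_apply hv') (hA.clm_apply hw')) (fun x hx => ?_) (fun s hs => ?_)
      (step1.congr fun t ht => ?_)
  · exact (hsymp x hx).detC_ne_zero (hlag _ hx.2) (hdet _ hx.2)
  · refine ⟨ρ, ?_⟩
    simp only [hend s hs]
    exact hρ _ (map_add _) (map_smul _)
  · simp only [hconst t ht]

/-! ### Tangent planes of embedded Lagrangian tori. -/

theorem IsLagrangianTorusEmbedding.range_eq_image_Icc {f : ℝ × ℝ → ℂ × ℂ}
    (hf : IsLagrangianTorusEmbedding f) : Set.range f = f '' Set.Icc (0 : ℝ × ℝ) 1 := by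
  refine Set.Subset.antisymm ?_ (Set.image_subset_range _ _)
  rintro _ ⟨p, rfl⟩
  refine ⟨(Int.fract p.1, Int.fract p.2), ⟨⟨Int.fract_nonneg _, Int.fract_nonneg _⟩,
    ⟨(Int.fract_lt_one _).le, (Int.fract_lt_one _).le⟩⟩, ?_⟩
  rw [hf.eq_iff]
  exact ⟨⌊p.1⌋, ⌊p.2⌋, Prod.ext (Int.fract_add_floor _).symm (Int.fract_add_floor _).symm⟩

open Filter Topology in
/-- Near a point `q`, a torus is covered by parameters near `q`. -/
theorem IsLagrangianTorusEmbedding.exists_seq_tendsto {f : ℝ × ℝ → ℂ × ℂ}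
    (hf : IsLagrangianTorusEmbedding f) {z : ℕ → ℂ × ℂ} (hz : ∀ n, z n ∈ Set.range f) {q : ℝ × ℝ}
    (hlim : Tendsto z atTop (𝓝 (f q))) :
    ∃ (σ : ℕ → ℕ) (p : ℕ → ℝ × ℝ), StrictMono σ ∧ Tendsto p atTop (𝓝 q) ∧
      ∀ n, f (p n) = z (σ n) := by
  choose p hpI hp using fun n => hf.range_eq_image_Icc ▸ hz n
  obtain ⟨p₀, -, σ, hσ, hσlim⟩ := isCompact_Icc.tendsto_subseq hpI
  have hf0 : f p₀ = f q := by
    refine tendsto_nhds_unique ((hf.smooth.continuous.tendsto p₀).comp hσlim) ?_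
    exact (hlim.comp hσ.tendsto_atTop).congr fun n => (hp _).symm
  -- The limit parameter may be a lattice translate of `q`; periodicity allows shifting the whole
  -- sequence.
  obtain ⟨m, n, hmn⟩ := (hf.eq_iff _ _).mp hf0
  refine ⟨σ, fun i => p (σ i) + ((m : ℝ), (n : ℝ)), hσ, ?_, fun i => ?_⟩
  · rw [hmn]
    exact hσlim.add_const _
  · rw [← hp (σ i)]
    exact ((hf.eq_iff _ _).mpr ⟨m, n, rfl⟩).symm

open Filter Topology in
-- A curve in the torus comes with no smooth lift to the parameter plane. Its velocity is instead
-- obtained as a limit of vectors in the range of `df`, using lifts of a sequence of its points.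
theorem IsLagrangianTorusEmbedding.tangentSpaceAt_range {f : ℝ × ℝ → ℂ × ℂ}
    (hf : IsLagrangianTorusEmbedding f) (q : ℝ × ℝ) :
    tangentSpaceAt (Set.range f) (f q) = LinearMap.range (fderiv ℝ f q : ℝ × ℝ →ₗ[ℝ] ℂ × ℂ) := by
  have hdf := ((hf.smooth.differentiable (by simp)) q).hasFDerivAt
  apply le_antisymm
  · refine Submodule.span_le.mpr ?_
    rintro _ ⟨γ, hγ, hmem, h0, rfl⟩
    have hγ' : HasDerivAt γ (deriv γ 0) 0 := ((hγ.differentiable (by simp)) 0).hasDerivAt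
    set t : ℕ → ℝ := fun n => 1 / ((n : ℝ) + 1)
    have ht : Tendsto t atTop (𝓝 0) := tendsto_one_div_add_atTop_nhds_zero_nat
    have ht0 : ∀ n, t n ≠ 0 := fun n => by positivity
    obtain ⟨σ, p, hσ, hp, hpz⟩ := hf.exists_seq_tendsto (z := fun n => γ (t n)) (q := q)
      (fun n => hmem _) (by rw [← h0]; exact (hγ.continuous.tendsto 0).comp ht)
    have htσ : Tendsto (t ∘ σ) atTop (𝓝 0) := ht.comp hσ.tendsto_atTop
    -- The injective differential is bounded below, so `p n - q` is controlled by `f (p n) - f q`,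
    -- hence by `t (σ n)`.
    obtain ⟨C, -, hC⟩ := (fderiv ℝ f q : ℝ × ℝ →ₗ[ℝ] ℂ × ℂ).exists_antilipschitzWith
      (LinearMap.ker_eq_bot.mpr (hf.immersion q))
    have h1 : (fun n => p n - q) =O[atTop] fun n => f (p n) - f q := by
      have hd : (fun n => p n - q) =O[atTop] fun n => fderiv ℝ f q (p n - q) :=
        Asymptotics.IsBigO.of_bound C (Eventually.of_forall fun n => by
          simpa using hC.le_mul_dist (p n - q) 0)
      have ho := ((hdf.isLittleO).comp_tendsto hp).trans_isBigO hd
      exact hd.trans (ho.right_isBigO_add.congr_right fun n => by simp)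
    have h2 : (fun n => f (p n) - f q) =O[atTop] fun n => t (σ n) := by
      have := (hγ'.hasFDerivAt.isBigO_sub).comp_tendsto htσ
      simpa [Function.comp_def, hpz, h0] using this
    have h3 : (fun n => f (p n) - f q - fderiv ℝ f q (p n - q)) =o[atTop] fun n => t (σ n) :=
      ((hdf.isLittleO).comp_tendsto hp).trans_isBigO (h1.trans h2)
    have h4 : Tendsto (fun n => (t (σ n))⁻¹ • (f (p n) - f q - fderiv ℝ f q (p n - q))) atTop
        (𝓝 0) := by
      rw [tendsto_zero_iff_norm_tendsto_zero]
      refine (h3.norm_norm.tendsto_div_nhds_zero).congr fun n => ?_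
      rw [norm_smul, norm_inv, div_eq_inv_mul]
    have h5 : Tendsto (fun n => (t (σ n))⁻¹ • (f (p n) - f q)) atTop (𝓝 (deriv γ 0)) := by
      have := (hasDerivAt_iff_tendsto_slope.mp hγ').comp
        (tendsto_nhdsWithin_iff.mpr ⟨htσ, Eventually.of_forall fun n => ht0 _⟩)
      refine this.congr fun n => ?_
      simp [slope, hpz, h0]
    -- The velocity is a limit of values of `df`, whose range is closed, being finite-dimensional.
    have h6 : Tendsto (fun n => fderiv ℝ f q ((t (σ n))⁻¹ • (p n - q))) atTop
        (𝓝 (deriv γ 0)) := by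
      have := h5.sub h4
      rw [sub_zero] at this
      refine this.congr fun n => ?_
      rw [← smul_sub, sub_sub_cancel, map_smul]
    exact (Submodule.closed_of_finiteDimensional _).mem_of_tendsto h6
      (Eventually.of_forall fun n => ⟨_, rfl⟩)
  · rintro _ ⟨h, rfl⟩
    refine Submodule.subset_span ⟨fun t => f (q + t • h), hf.smooth.comp (by fun_prop),
      fun t => ⟨_, rfl⟩, by simp, ?_⟩
    have hl : HasDerivAt (fun t : ℝ => q + t • h) h 0 := by
      simpa using ((hasDerivAt_id (0 : ℝ)).smul_const h).const_add q
    have hdf' : HasFDerivAt f (fderiv ℝ f q) (q + (0 : ℝ) • h) := by simpa using hdf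
    exact (hdf'.comp_hasDerivAt 0 hl).deriv

theorem IsLagrangianTorus.omegaStd_eq_zero {L : Set (ℂ × ℂ)} (hL : IsLagrangianTorus L)
    {z v w : ℂ × ℂ} (hz : z ∈ L) (hv : v ∈ tangentSpaceAt L z) (hw : w ∈ tangentSpaceAt L z) :
    omegaStd v w = 0 := by
  obtain ⟨f, hf, rfl⟩ := hL
  obtain ⟨q, rfl⟩ := hz
  rw [hf.tangentSpaceAt_range] at hv hw
  obtain ⟨a, rfl⟩ := hv
  obtain ⟨b, rfl⟩ := hw
  exact hf.lagrangian q a b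

theorem IsLagrangianTorus.isCompact {L : Set (ℂ × ℂ)} (hL : IsLagrangianTorus L) :
    IsCompact L := by
  obtain ⟨f, hf, rfl⟩ := hL
  rw [hf.range_eq_image_Icc]
  exact isCompact_Icc.image hf.smooth.continuous

/-! ### Images of tori and of their Maslov indices. -/

namespace IsSymplecticEmbedding

variable {φ : ℂ × ℂ → ℂ × ℂ} {X Y : Set (ℂ × ℂ)}

theorem hasFDerivAt (hφ : IsSymplecticEmbedding φ X Y) (hX : IsOpen X) {z : ℂ × ℂ} (hz : z ∈ X) :
    HasFDerivAt φ (fderiv ℝ φ z) z :=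
  ((hφ.smooth.contDiffAt (hX.mem_nhds hz)).differentiableAt (by simp)).hasFDerivAt

theorem isLagrangianTorusEmbedding_comp (hφ : IsSymplecticEmbedding φ X Y) (hX : IsOpen X)
    {f : ℝ × ℝ → ℂ × ℂ} (hf : IsLagrangianTorusEmbedding f) (hfX : ∀ q, f q ∈ X) :
    IsLagrangianTorusEmbedding (φ ∘ f) := by
  have hd : ∀ q, fderiv ℝ (φ ∘ f) q = (fderiv ℝ φ (f q)).comp (fderiv ℝ f q) := fun q =>
    ((hφ.hasFDerivAt hX (hfX q)).comp q
      ((hf.smooth.differentiable (by simp)) q).hasFDerivAt).fderiv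
  refine ⟨contDiff_iff_contDiffAt.mpr fun q => (hφ.smooth.contDiffAt
    (hX.mem_nhds (hfX q))).comp q hf.smooth.contDiffAt, fun p q => ?_, fun q => ?_,
    fun q v w => ?_⟩
  · rw [← hf.eq_iff]
    exact hφ.injOn.eq_iff (hfX p) (hfX q)
  · rw [hd]
    refine Function.Injective.comp (g := fderiv ℝ φ (f q)) ?_ (hf.immersion q)
    refine (injective_iff_map_eq_zero _).mpr fun v hv => ?_
    exact IsSymplecticMap.eq_zero (hφ.symplectic _ (hfX q)) hv
  · rw [hd]
    exact (hφ.symplectic _ (hfX q) _ _).trans (hf.lagrangian q v w)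

theorem isLagrangianTorus_image (hφ : IsSymplecticEmbedding φ X Y) (hX : IsOpen X)
    {L : Set (ℂ × ℂ)} (hL : IsLagrangianTorus L) (hLX : L ⊆ X) : IsLagrangianTorus (φ '' L) := by
  obtain ⟨f, hf, rfl⟩ := hL
  exact ⟨φ ∘ f, hφ.isLagrangianTorusEmbedding_comp hX hf fun q => hLX ⟨q, rfl⟩, Set.range_comp _ _⟩

theorem tangentSpaceAt_image (hφ : IsSymplecticEmbedding φ X Y) (hX : IsOpen X)
    {L : Set (ℂ × ℂ)} (hL : IsLagrangianTorus L) (hLX : L ⊆ X) {z : ℂ × ℂ} (hz : z ∈ L) :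
    tangentSpaceAt (φ '' L) (φ z)
      = (tangentSpaceAt L z).map (fderiv ℝ φ z : ℂ × ℂ →ₗ[ℝ] ℂ × ℂ) := by
  obtain ⟨f, hf, rfl⟩ := hL
  obtain ⟨q, rfl⟩ := hz
  have hfX : ∀ q, f q ∈ X := fun q => hLX ⟨q, rfl⟩
  rw [← Set.range_comp, hf.tangentSpaceAt_range]
  change tangentSpaceAt (Set.range (φ ∘ f)) ((φ ∘ f) q) = _
  rw [(hφ.isLagrangianTorusEmbedding_comp hX hf hfX).tangentSpaceAt_range,
    ((hφ.hasFDerivAt hX (hfX q)).comp q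
      ((hf.smooth.differentiable (by simp)) q).hasFDerivAt).fderiv]
  exact LinearMap.range_comp _ _

theorem hasMaslovIndex_image (hφ : IsSymplecticEmbedding φ X Y) (hX : IsStarShapedDomain X)
    {L : Set (ℂ × ℂ)} (hL : IsLagrangianTorus L) (hLX : L ⊆ X) {x : L} (u : SmoothLoop L x) {k : ℤ}
    (hk : HasMaslovIndex (fun t => tangentSpaceAt L (u.toFun t)) k) :
    HasMaslovIndex (fun t => tangentSpaceAt (φ '' L) (φ (u.toFun t))) k := by
  obtain ⟨hXo, p, hp, hstar⟩ := hX
  obtain ⟨v, w, α, hv, hw, hα, h, hαk⟩ := hk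
  have huX : ∀ t, u.toFun t ∈ X := fun t => hLX (u.mem t)
  have hu1 : u.toFun 1 = u.toFun 0 := by simpa using u.periodic 0
  have hmemv : ∀ t ∈ Set.Icc (0 : ℝ) 1, v t ∈ tangentSpaceAt L (u.toFun t) := fun t ht => by
    exact (h t ht).1.ge (Submodule.subset_span (by simp))
  have hmemw : ∀ t ∈ Set.Icc (0 : ℝ) 1, w t ∈ tangentSpaceAt L (u.toFun t) := fun t ht => by
    exact (h t ht).1.ge (Submodule.subset_span (by simp))
  have hlag : ∀ t ∈ Set.Icc (0 : ℝ) 1, omegaStd (v t) (w t) = 0 := fun t ht =>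
    hL.omegaStd_eq_zero (u.mem t) (hmemv t ht) (hmemw t ht)
  have hspan : tangentSpaceAt L (u.toFun 1) = Submodule.span ℝ {v 0, w 0} := by
    rw [hu1]; exact (h 0 (by simp)).1
  -- The radial contraction of `u` to `p` stays in `X`; `dφ` along it is the homotopy from the
  -- constant loop `dφ_p` to `dφ_{u(t)}`.
  set c : ℝ × ℝ → ℂ × ℂ := fun x => p + x.1 • (u.toFun x.2 - p)
  have hcX : ∀ x ∈ Set.Icc (0 : ℝ) 1 ×ˢ Set.Icc (0 : ℝ) 1, c x ∈ X := fun x hx =>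
    hstar.add_smul_sub_mem (huX _) hx.1.1 hx.1.2
  have hc : Continuous c := by
    have := u.smooth.continuous
    fun_prop
  have hdφ : ContinuousOn (fderiv ℝ φ) X :=
    hφ.smooth.continuousOn_fderiv_of_isOpen hXo (by simp)
  have key := HasSquareWinding.of_symplectic_homotopy (A := fun x => fderiv ℝ φ (c x))
    (hdφ.comp hc.continuousOn hcX) (fun x hx => hφ.symplectic _ (hcX x hx))
    (fun s _ => by simp only [c, hu1]) (A₀ := fderiv ℝ φ p) (fun t _ => by simp [c]) hv hw
    (fun t ht => (h t ht).2.1) hlag (hspan ▸ hmemv 1 (by simp)) (hspan ▸ hmemw 1 (by simp))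
    (k := k) ⟨α, hα, fun t ht => (h t ht).2.2, hαk⟩
  simp only [c, one_smul, add_sub_cancel] at key
  obtain ⟨β, hβ, hβ', hβk⟩ := key
  have hdu : ContinuousOn (fun t => fderiv ℝ φ (u.toFun t)) (Set.Icc 0 1) :=
    hdφ.comp u.smooth.continuous.continuousOn fun t _ => huX t
  refine ⟨_, _, β, hdu.clm_apply hv, hdu.clm_apply hw, hβ, fun t ht => ⟨?_, ?_, hβ' t ht⟩, hβk⟩
  · simp only [hφ.tangentSpaceAt_image hXo hL hLX (u.mem t), (h t ht).1, Submodule.map_span,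
      Set.image_pair]
    rfl
  · exact IsSymplecticMap.detC_ne_zero (hφ.symplectic _ (huX t)) (hlag t ht) (h t ht).2.1

end IsSymplecticEmbedding

/-! ### Integrals of closed one-forms. -/

open unitInterval in
/-- A closed one-form on a star-shaped open set has integral zero over every `C²` loop. -/
theorem integral_eq_zero_of_closed_of_starConvex {E : Type*} [NormedAddCommGroup E]
    [NormedSpace ℝ E] {X : Set E} {p : E} (hX : StarConvex ℝ p X)
    {η : E → E →L[ℝ] ℝ} {dη : E → E →L[ℝ] E →L[ℝ] ℝ} (hη : ∀ z ∈ X, HasFDerivAt η (dη z) z)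
    (hsymm : ∀ z ∈ X, ∀ a b, dη z a b = dη z b a) {u : ℝ → E} (hu : ContDiff ℝ 2 u)
    (huX : ∀ t, u t ∈ X) (hu1 : u 1 = u 0) : ∫ t in (0 : ℝ)..1, η (u t) (deriv u t) = 0 := by
  let γ : Path (u 0) (u 1) := ⟨⟨fun t : I => u t, by have := hu.continuous; fun_prop⟩,
    by simp, by simp⟩
  set H := ContinuousMap.Homotopy.affine (γ : C(I, E)) (Path.refl p : C(I, E))
  have hH : ∀ s t : I, H (s, t) = p + (1 - s : ℝ) • (u t - p) := fun s t => by
    simp [H, γ, AffineMap.lineMap_apply]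
    module
  have hK : Set.range H ⊆ X := by
    rintro _ ⟨⟨s, t⟩, rfl⟩
    rw [hH]
    exact hX.add_smul_sub_mem (huX _) (sub_nonneg.mpr s.2.2) (by linarith [s.2.1])
  have hKc : IsClosed (Set.range H) := (isCompact_range H.continuous).isClosed
  -- Stokes' formula for the cone over the loop. Its compact image serves as the domain, so the
  -- conditions on the closure only concern points of `X`.
  have key := H.curveIntegral_add_curveIntegral_eq_of_hasFDerivWithinAt (t := Set.range H)
    (fun a _ b _ => ⟨_, rfl⟩) (fun x hx => (hη x (hK hx)).hasFDerivWithinAt)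
    (by rw [hKc.closure_eq]; exact fun x hx => (hη x (hK hx)).continuousAt.continuousWithinAt)
    (fun x hx a _ b _ => hsymm x (hK hx) a b)
    (by
      refine ContDiffOn.congr (f := fun y : ℝ × ℝ => p + (1 - y.1) • (u y.2 - p)) ?_ ?_
      · exact ContDiff.contDiffOn (by fun_prop)
      · rw [Set.Icc_prod_eq]
        rintro ⟨s, t⟩ ⟨hs, ht⟩
        lift s to I using hs
        lift t to I using ht
        rw [← hH]
        simp)
  -- The two sides of the homotopy square are the same segment from `u 0 = u 1` to `p`, so they
  -- cancel.
  have e : ∫ᶜ z in H.evalAt 1, η z = ∫ᶜ z in H.evalAt 0, η z := by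
    have hext : (H.evalAt 1).extend = (H.evalAt 0).extend := by
      ext s
      have hs : H (Set.projIcc 0 1 zero_le_one s, 1) = H (Set.projIcc 0 1 zero_le_one s, 0) := by
        rw [hH, hH, Set.Icc.coe_one, Set.Icc.coe_zero, hu1]
      exact hs
    simp only [curveIntegral_def, curveIntegralFun_def, hext]
  rw [e, add_left_inj, curveIntegral_refl, curveIntegral_def] at key
  refine Eq.trans ?_ key
  refine intervalIntegral.integral_congr fun t ht => ?_
  rw [Set.uIcc_of_le zero_le_one] at ht
  have hext : Set.EqOn γ.extend u I := fun s hs => γ.extend_apply hs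
  rw [curveIntegralFun_def, hext ht, derivWithin_congr hext (hext ht),
    ((hu.differentiable (by simp)) t).derivWithin (uniqueDiffOn_Icc_zero_one t ht)]

/-! ### Induced maps on homology, and the Liouville form. -/

/-- A homeomorphism induces an isomorphism of fundamental groups. -/
theorem bijective_fundamentalGroup_map {A B : Type*} [TopologicalSpace A] [TopologicalSpace B]
    (h : A ≃ₜ B) (x : A) : Function.Bijective (FundamentalGroup.map (h : C(A, B)) x) := by
  constructor
  · intro a b hab
    induction a using Path.Homotopic.Quotient.ind with | mk a
    induction b using Path.Homotopic.Quotient.ind with | mk b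
    have hx := (h.symm_apply_apply x).symm
    have hret : ∀ c : Path x x, (((Path.Homotopic.Quotient.mk c).map (h : C(A, B))).map
        (h.symm : C(B, A))).cast hx hx = Path.Homotopic.Quotient.mk c := fun c => by
      change Path.Homotopic.Quotient.mk _ = _
      congr 1
      ext t
      simp
    have hab' : (Path.Homotopic.Quotient.mk a).map (h : C(A, B))
      = (Path.Homotopic.Quotient.mk b).map (h : C(A, B)) := hab
    rw [← hret a, ← hret b, hab']
  · intro b
    induction b using Path.Homotopic.Quotient.ind with | mk b
    refine ⟨FundamentalGroup.fromPath (Path.Homotopic.Quotient.mk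
      ((b.map h.symm.continuous).cast (h.symm_apply_apply x).symm (h.symm_apply_apply x).symm)), ?_⟩
    change Path.Homotopic.Quotient.mk _ = _
    congr 1
    ext t
    simp

/-- The Liouville form as a continuous bilinear map. -/
noncomputable def liouvilleCLM : ℂ × ℂ →L[ℝ] ℂ × ℂ →L[ℝ] ℝ :=
  -((Complex.imCLM.comp (ContinuousLinearMap.fst ℝ ℂ ℂ)).smulRight
      (Complex.reCLM.comp (ContinuousLinearMap.fst ℝ ℂ ℂ))
    + (Complex.imCLM.comp (ContinuousLinearMap.snd ℝ ℂ ℂ)).smulRight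
      (Complex.reCLM.comp (ContinuousLinearMap.snd ℝ ℂ ℂ)))

theorem liouvilleCLM_apply (z v : ℂ × ℂ) : liouvilleCLM z v = liouville z v := by
  simp [liouvilleCLM, liouville]

theorem liouvilleCLM_sub_swap (v w : ℂ × ℂ) :
    liouvilleCLM v w - liouvilleCLM w v = omegaStd v w := by
  simp only [liouvilleCLM_apply, liouville, omegaStd]; ring

/-- The homeomorphism of a torus onto its image under an injective continuous map. -/
theorem exists_homeomorph_image {A B : Type*} [TopologicalSpace A] [TopologicalSpace B] [T2Space B]
    {φ : A → B} {L : Set A} (hL : IsCompact L) (hc : ContinuousOn φ L) (hi : Set.InjOn φ L) :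
    ∃ h : L ≃ₜ φ '' L, ∀ y, (h y : B) = φ y := by
  have := isCompact_iff_compactSpace.mp hL
  have hcont : Continuous (Equiv.Set.imageOfInjOn φ L hi) :=
    Continuous.subtype_mk (continuousOn_iff_continuous_domRestrict.mp hc) _
  exact ⟨hcont.homeoOfEquivCompactToT2, fun _ => rfl⟩

/-- The isomorphism of first homology groups induced by a homeomorphism. -/
noncomputable def homologyEquiv {L L' : Set (ℂ × ℂ)} (h : L ≃ₜ L') (x : L) :
    H1 L x ≃ₗ[ℤ] H1 L' (h x) :=
  (MulEquiv.toAdditive (MulEquiv.ofBijective _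
    (bijective_fundamentalGroup_map h x)).abelianizationCongr).toIntLinearEquiv

/-! ### Transport of loops, areas and bases. -/

namespace IsSymplecticEmbedding

variable {φ : ℂ × ℂ → ℂ × ℂ} {X Y : Set (ℂ × ℂ)} {L : Set (ℂ × ℂ)} {x : L}

/-- The image of a smooth loop under a symplectic embedding. -/
def mapLoop (hφ : IsSymplecticEmbedding φ X Y) (hX : IsOpen X) (hLX : L ⊆ X) (h : L ≃ₜ φ '' L)
    (hh : ∀ y, (h y : ℂ × ℂ) = φ y) (u : SmoothLoop L x) : SmoothLoop (φ '' L) (h x) where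
  toFun t := φ (u.toFun t)
  smooth := contDiff_iff_contDiffAt.mpr fun t => (hφ.smooth.contDiffAt
    (hX.mem_nhds (hLX (u.mem t)))).comp t u.smooth.contDiffAt
  periodic t := congrArg φ (u.periodic t)
  mem t := ⟨_, u.mem t, rfl⟩
  base := by rw [u.base, hh]

variable (hφ : IsSymplecticEmbedding φ X Y) (hLX : L ⊆ X) (h : L ≃ₜ φ '' L)
  (hh : ∀ y, (h y : ℂ × ℂ) = φ y)

theorem homologyClass_mapLoop (hX : IsOpen X) (u : SmoothLoop L x) :
    (hφ.mapLoop hX hLX h hh u).homologyClass = homologyEquiv h x u.homologyClass := by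
  change _ = Additive.ofMul (Abelianization.of (FundamentalGroup.fromPath
    (Path.Homotopic.Quotient.mk (u.path.map h.continuous))))
  rw [SmoothLoop.homologyClass]
  congr 4
  exact Path.ext (funext fun t => Subtype.ext (hh (u.path t)).symm)

theorem area_mapLoop (hX : IsStarShapedDomain X) (u : SmoothLoop L x) :
    (hφ.mapLoop hX.1 hLX h hh u).area = u.area := by
  have hXo := hX.1
  obtain ⟨-, p, -, hstar⟩ := hX
  have hcont : ∀ w : ℝ → ℂ × ℂ, ContDiff ℝ ∞ w →
      Continuous fun t => liouvilleCLM (w t) (deriv w t) := fun w hw =>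
    (liouvilleCLM.continuous.comp hw.continuous).clm_apply (hw.continuous_deriv (by simp))
  have huX : ∀ t, u.toFun t ∈ X := fun t => hLX (u.mem t)
  have hsnd : ∀ z ∈ X, HasFDerivAt (fderiv ℝ φ) (fderiv ℝ (fderiv ℝ φ) z) z := fun z hz =>
    (((hφ.smooth.contDiffAt (hXo.mem_nhds hz)).fderiv_right (m := 1)
      (WithTop.coe_le_coe.mpr (le_top : (1 + 1 : ℕ∞) ≤ ⊤))).differentiableAt (by simp)).hasFDerivAt
  -- This differentiates `φ^*λ - λ`. Antisymmetrizing, the second derivative of `φ` drops out by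
  -- symmetry and what remains is `φ^*ω - ω = 0`.
  have hη := fun z hz => (((liouvilleCLM.hasFDerivAt.comp z (hφ.hasFDerivAt hXo hz)).clm_comp
    (hsnd z hz)).sub (liouvilleCLM.hasFDerivAt (x := z)))
  have key := integral_eq_zero_of_closed_of_starConvex hstar hη (fun z hz a b => by
    have hs : fderiv ℝ (fderiv ℝ φ) z a b = fderiv ℝ (fderiv ℝ φ) z b a :=
      (hφ.smooth.contDiffAt (hXo.mem_nhds hz)).isSymmSndFDerivAt 
        (by simpa using WithTop.coe_le_coe.mpr (le_top : (2 : ℕ∞) ≤ ⊤)) a b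
    have h1 := liouvilleCLM_sub_swap (fderiv ℝ φ z a) (fderiv ℝ φ z b)
    rw [hφ.symplectic z hz, ← liouvilleCLM_sub_swap] at h1
    simp [hs]
    linarith) (u.smooth.of_le (WithTop.coe_le_coe.mpr (le_top : (2 : ℕ∞) ≤ ⊤))) huX
      (by simpa using u.periodic 0)
  have hv := hφ.mapLoop hXo hLX h hh u |>.smooth
  have hd : ∀ t, deriv (fun t => φ (u.toFun t)) t = fderiv ℝ φ (u.toFun t) (deriv u.toFun t) :=
    fun t => ((hφ.hasFDerivAt hXo (huX t)).comp_hasDerivAt t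
      ((u.smooth.differentiable (by simp)) t).hasDerivAt).deriv
  rw [← sub_eq_zero, ← key]
  simp only [SmoothLoop.area, ← liouvilleCLM_apply]
  rw [← intervalIntegral.integral_sub ((hcont _ hv).intervalIntegrable _ _)
    ((hcont _ u.smooth).intervalIntegrable _ _)]
  refine intervalIntegral.integral_congr fun t _ => ?_
  simp [mapLoop, hd]

theorem reducedShape_subset (hφ : IsSymplecticEmbedding φ X Y) (hX : IsStarShapedDomain X) :
    reducedShape X ⊆ reducedShape Y := by
  rintro ⟨a, b⟩ ⟨L, hL, hLX, x, e, hm0, hm1, ha0, ha1, hab⟩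
  obtain ⟨h, hh⟩ := exists_homeomorph_image hL.isCompact (hφ.smooth.continuousOn.mono hLX)
    (hφ.injOn.mono hLX)
  have hMaslov : ∀ {c : H1 L x} {k : ℤ}, HasMaslovOn c k → HasMaslovOn (homologyEquiv h x c) k := by
    rintro _ k ⟨u, rfl, hk⟩
    exact ⟨hφ.mapLoop hX.1 hLX h hh u, hφ.homologyClass_mapLoop hLX h hh hX.1 u,
      hφ.hasMaslovIndex_image hX hL hLX u hk⟩
  have hArea : ∀ {c : H1 L x} {s : ℝ}, HasAreaOn c s → HasAreaOn (homologyEquiv h x c) s := by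
    rintro _ _ ⟨u, rfl, rfl⟩
    exact ⟨hφ.mapLoop hX.1 hLX h hh u, hφ.homologyClass_mapLoop hLX h hh hX.1 u,
      hφ.area_mapLoop hLX h hh hX u⟩
  refine ⟨φ '' L, hφ.isLagrangianTorus_image hX.1 hL hLX, (hφ.mapsTo.mono_left hLX).image_subset,
    h x, e.map (homologyEquiv h x), ?_, ?_, ?_, ?_, hab⟩ <;> rw [Module.Basis.map_apply]
  exacts [hMaslov hm0, hMaslov hm1, hArea ha0, hArea ha1]

/-- A smooth inverse of a symplectic diffeomorphism is symplectic. -/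
theorem inverse (hφ : IsSymplecticEmbedding φ X Y) (hX : IsOpen X) (hY : IsOpen Y)
    {ψ : ℂ × ℂ → ℂ × ℂ} (hψ : ContDiffOn ℝ ∞ ψ Y) (hm : Set.MapsTo ψ Y X)
    (hinv : Set.RightInvOn ψ φ Y) : IsSymplecticEmbedding ψ Y X := by
  refine ⟨hψ, hinv.injOn, hm, fun z hz v w => ?_⟩
  have hψz := ((hψ.contDiffAt (hY.mem_nhds hz)).differentiableAt (by simp)).hasFDerivAt
  have hid : (fderiv ℝ φ (ψ z)).comp (fderiv ℝ ψ z) = ContinuousLinearMap.id ℝ (ℂ × ℂ) := by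
    refine ((hφ.hasFDerivAt hX (hm hz)).comp z hψz).unique ?_
    refine (hasFDerivAt_id z).congr_of_eventuallyEq ?_
    filter_upwards [hY.mem_nhds hz] with y hy using hinv hy
  have hap : ∀ v, fderiv ℝ φ (ψ z) (fderiv ℝ ψ z v) = v := fun v => DFunLike.congr_fun hid v
  rw [← hφ.symplectic _ (hm hz), hap, hap]

end IsSymplecticEmbedding

end ShapeInvariant

theorem mainTheorem7 (X Y : Set (ℂ × ℂ))
    (hX : ShapeInvariant.IsStarShapedDomain X) (hY : ShapeInvariant.IsStarShapedDomain Y) :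
    ((∃ φ : ℂ × ℂ → ℂ × ℂ, ShapeInvariant.IsSymplecticEmbedding φ X Y) →
      ShapeInvariant.reducedShape X ⊆ ShapeInvariant.reducedShape Y) ∧
    (ShapeInvariant.Symplectomorphic X Y →
      ShapeInvariant.reducedShape X = ShapeInvariant.reducedShape Y) := by
  refine ⟨fun ⟨φ, hφ⟩ => hφ.reducedShape_subset hX, fun ⟨φ, ψ, hφ, hψ, hm, hinv⟩ => ?_⟩
  exact (hφ.reducedShape_subset hX).antisymm
    ((hφ.inverse hX.1 hY.1 hψ hm hinv.2).reducedShape_subset hY)
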